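/- Let $r(t,u)=\dfrac{1}{1+(t-u)^2}$, $t,u\in\mathbb{R}$, be the Cauchy kernel; it is a symmetric positive semidefinite kernel. Let $\mathscr{H}_r(\mathbb{R})$ be its reproducing kernel Hilbert space of functions $\mathbb{R}\to\mathbb{C}$, and let $z^*$ denote the complex conjugate of $z\in\mathbb{C}$. For $m\in\mathbb{N}_0=\{0,1,2,\dots\}$ and $t\in\mathbb{R}$ define $$\psi_m(t)=-\frac{1}{\sqrt2}\,\frac{(it)^m}{(it-1)^{m+1}},\qquad \psi_{-m-1}(t)=-\frac{1}{\sqrt2}\,\frac{(it)^m}{(it+1)^{m+1}},$$ (with $(it)^0=1$ also for $t=0$) and $$\alpha_m(t)=\frac{1}{\sqrt2}\bigl(\psi_m(t)+\psi_m^*(t)\bigr),\qquad \beta_m(t)=\frac{1}{i\sqrt2}\bigl(\psi_m(t)-\psi_m^*(t)\bigr).$$ Then the functions $\alpha_m$ and $\beta_m$ are real-valued, the family $\{\psi_m\}_{m\in\mathbb{Z}}$ is an orthonormal basis of $\mathscr{H}_r(\mathbb{R})$, and so is the family consisting of all $\alpha_m$ and all $\beta_m$, $m\in\mathbb{N}_0$.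 Moreover, for all $t,u\in\mathbb{R}$, $$r(t,u)=\sum_{m\in\mathbb{Z}}\psi_m^*(t)\,\psi_m(u)=\sum_{m=0}^\infty\alpha_m(t)\,\alpha_m(u)+\sum_{m=0}^\infty\beta_m(t)\,\beta_m(u),$$ where each of the three series converges unconditionally. -/

import Mathlib

open scoped ComplexConjugate

noncomputable section

/-- The Cauchy kernel `r(t, u) = 1 / (1 + (t - u)²)`. -/
def cauchyKernel (t u : ℝ) : ℝ := 1 / (1 + (t - u) ^ 2)

/-- The Cauchy kernel in the form in which Mathlib's `RKHS` takes a scalar kernel: the entry at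
`(t, u)` is the operator on `ℂ` "multiply by `r(t, u)`". -/
def cauchyKernelMatrix : Matrix ℝ ℝ (ℂ →L[ℂ] ℂ) :=
  .of fun t u ↦ (cauchyKernel t u : ℂ) • ContinuousLinearMap.id ℂ ℂ

/-- The complex-valued Cauchy–Laguerre functions `ψ_m`, `m ∈ ℤ`
(`Int.negSucc m` is the integer `-m - 1`). -/
def cauchyPsi : ℤ → ℝ → ℂ
  | Int.ofNat m, t =>
      -(1 / (Real.sqrt 2 : ℂ)) * ((Complex.I * t) ^ m / (Complex.I * t - 1) ^ (m + 1))
  | Int.negSucc m, t =>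
      -(1 / (Real.sqrt 2 : ℂ)) * ((Complex.I * t) ^ m / (Complex.I * t + 1) ^ (m + 1))

/-- The real-valued Cauchy–Laguerre functions `α_m = (ψ_m + ψ_m^*) / √2`, seen as functions
into `ℂ`. -/
def cauchyAlpha (m : ℕ) (t : ℝ) : ℂ :=
  1 / (Real.sqrt 2 : ℂ) * (cauchyPsi m t + conj (cauchyPsi m t))

/-- The real-valued Cauchy–Laguerre functions `β_m = (ψ_m - ψ_m^*) / (i √2)`, seen as functions
into `ℂ`. -/
def cauchyBeta (m : ℕ) (t : ℝ) : ℂ :=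
  1 / (Complex.I * (Real.sqrt 2 : ℂ)) * (cauchyPsi m t - conj (cauchyPsi m t))

end

/-! If K(s,t) = ∑ e_i(s) conj(e_i(t)), the vectors v_t = (conj e_i(t))_i in ℓ² have Gram matrix K,
so sending kernel functions to v_t extends to an isometry of the RKHS into ℓ². It is onto, with e_i
matching the standard basis, once no nonzero c in ℓ² has ∑ c_i e_i = 0 pointwise
(`RKHS.exists_hilbertBasis_of_hasSum`).

The kernel expansion is a pair of geometric series (`hasSum_conj_cauchyPsi_mul`). For independence,
w = z/(z-1) turns the series in ψ_m, m ≥ 0, at z = it into a power series with ℓ² coefficients,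
analytic for Re z < 1/2; the other ψ_m give one analytic for Re z > -1/2. If the total vanishes on
the imaginary axis, the halves glue to a bounded entire function decaying along the negative reals,
so Liouville makes it zero (`laguerreSum_eq_zero_of_eq_on_imaginary_axis`). The α_m, β_m come from
ψ_m, ψ_{-m-1} by a unitary 2×2 matrix. -/

/-! ### Orthonormal bases from kernel expansions -/

theorem denseRange_linearCombination {X G : Type*} [NormedAddCommGroup G]
    [InnerProductSpace ℂ G] {g : X → G}
    (hg : (Submodule.span ℂ (Set.range g)).topologicalClosure = ⊤) :
    DenseRange (Finsupp.linearCombination ℂ g) := by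
  rw [DenseRange, ← LinearMap.coe_range, Finsupp.range_linearCombination]
  exact Submodule.dense_iff_topologicalClosure_eq_top.2 hg

/-- Two vector families with the same Gram matrix and dense spans are related by a unitary. -/
theorem exists_linearIsometryEquiv_of_inner_eq {X E F : Type*}
    [NormedAddCommGroup E] [InnerProductSpace ℂ E] [CompleteSpace E]
    [NormedAddCommGroup F] [InnerProductSpace ℂ F] [CompleteSpace F] {k : X → E} {v : X → F}
    (hkv : ∀ x y, inner ℂ (k x) (k y) = inner ℂ (v x) (v y))
    (hk : (Submodule.span ℂ (Set.range k)).topologicalClosure = ⊤)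
    (hv : (Submodule.span ℂ (Set.range v)).topologicalClosure = ⊤) :
    ∃ W : E ≃ₗᵢ[ℂ] F, ∀ x, W (k x) = v x := by
  have hnorm (c : X →₀ ℂ) :
      ‖Finsupp.linearCombination ℂ v (LinearEquiv.refl ℂ (X →₀ ℂ) c)‖ =
        ‖Finsupp.linearCombination ℂ k c‖ := by
    rw [LinearEquiv.refl_apply, norm_eq_sqrt_re_inner (𝕜 := ℂ), norm_eq_sqrt_re_inner (𝕜 := ℂ)]
    simp only [Finsupp.linearCombination_apply, Finsupp.sum_inner, Finsupp.inner_sum, hkv,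
      inner_smul_left, inner_smul_right]
  have hk' := denseRange_linearCombination hk
  have hv' := denseRange_linearCombination hv
  refine ⟨(LinearEquiv.refl ℂ (X →₀ ℂ)).extendOfIsometry _ _ hk' hv' hnorm, fun x ↦ ?_⟩
  have := LinearEquiv.extendOfIsometry_eq (LinearEquiv.refl ℂ (X →₀ ℂ)) _ _ hk' hv' hnorm
    (Finsupp.single x 1)
  simpa using this

/-- The feature vector in `ℓ²` of a point, for a kernel expanded as `∑ i, e i s * conj (e i t)`. -/
theorem exists_lp_featureMap {X ι : Type*} {K : X → X → ℂ} {e : ι → X → ℂ}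
    (hK : ∀ s t, HasSum (fun i ↦ e i s * conj (e i t)) (K s t)) :
    ∃ v : X → lp (fun _ : ι ↦ ℂ) 2, (∀ t i, v t i = conj (e i t)) ∧
      ∀ s t, inner ℂ (v s) (v t) = K s t := by
  have hmem (t : X) : Memℓp (fun i ↦ conj (e i t)) 2 := by
    refine memℓp_gen ?_
    have := (hK t t).summable.norm
    refine this.congr fun i ↦ ?_
    simp [sq]
  refine ⟨fun t ↦ ⟨_, hmem t⟩, fun t i ↦ rfl, fun s t ↦ ?_⟩
  refine (lp.hasSum_inner (𝕜 := ℂ) _ _).unique ?_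
  have : (fun i ↦ e i s * conj (e i t)) =
      fun i ↦ inner ℂ (conj (e i s)) (conj (e i t)) := by
    ext i
    simp [mul_comm]
  exact this ▸ hK s t

/-- A family `e` with `K s t = ∑ i, e i s * conj (e i t)` that is `ℓ²`-linearly independent is a
Hilbert basis of the reproducing kernel Hilbert space with kernel `K`. -/
theorem RKHS.exists_hilbertBasis_of_hasSum {X ι H : Type*} [NormedAddCommGroup H]
    [InnerProductSpace ℂ H] [CompleteSpace H] [RKHS ℂ H X ℂ] {e : ι → X → ℂ}
    (hK : ∀ s t, HasSum (fun i ↦ e i s * conj (e i t)) (RKHS.kernel H s t 1))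
    (hinj : ∀ c : ι → ℂ, Summable (fun i ↦ ‖c i‖ ^ 2) → (∀ t, HasSum (fun i ↦ c i * e i t) 0) →
      ∀ i, c i = 0) :
    ∃ b : HilbertBasis ι ℂ H, ∀ i t, b i t = e i t := by
  obtain ⟨v, hv, hvK⟩ := exists_lp_featureMap hK
  obtain ⟨W, hW⟩ : ∃ W : H ≃ₗᵢ[ℂ] lp (fun _ : ι ↦ ℂ) 2, ∀ t, W (RKHS.kerFun H t (1 : ℂ)) = v t := by
    refine exists_linearIsometryEquiv_of_inner_eq (fun s t ↦ ?_) ?_ ?_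
    · rw [hvK, RKHS.kerFun_inner, RKHS.kerFun_apply]
      simp
    · rw [eq_top_iff, ← RKHS.kerFun_dense (𝕜 := ℂ) H]
      refine Submodule.topologicalClosure_mono (Submodule.span_le.2 ?_)
      rintro _ ⟨t, z, rfl⟩
      have : RKHS.kerFun H t z = z • RKHS.kerFun H t (1 : ℂ) := by
        rw [← map_smul, smul_eq_mul, mul_one]
      rw [this]
      exact Submodule.smul_mem _ _ (Submodule.subset_span ⟨t, rfl⟩)
    -- Orthogonality of c to every v t says exactly that ∑ c_i e_i(t) = 0.
    · rw [Submodule.topologicalClosure_eq_top_iff, Submodule.eq_bot_iff]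
      intro c hc
      ext i
      refine hinj c ?_ (fun t ↦ ?_) i
      · simpa using (lp.memℓp c).summable (by norm_num)
      have h0 : inner ℂ (v t) c = 0 :=
        Submodule.inner_right_of_mem_orthogonal (Submodule.subset_span (Set.mem_range_self t)) hc
      have := lp.hasSum_inner (𝕜 := ℂ) (v t) c
      rw [h0] at this
      simpa [hv, RCLike.inner_apply] using this
  classical
  refine ⟨.ofRepr W, fun i t ↦ ?_⟩
  -- By the reproducing property, this inner product is the value at t of the i-th basis vector.
  have h1 : inner ℂ (RKHS.kerFun H t (1 : ℂ)) (W.symm (lp.single 2 i (1 : ℂ))) = e i t := by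
    rw [← W.inner_map_map, hW, W.apply_symm_apply, lp.inner_single_right, hv]
    simp
  rw [RKHS.kerFun_inner] at h1
  rw [← h1, ← HilbertBasis.repr_symm_single]
  simp

open scoped ComplexOrder in
/-- A scalar kernel that is the Gram matrix of a family of vectors is positive semidefinite. -/
theorem posSemidef_of_inner_eq {X E : Type*} [NormedAddCommGroup E] [InnerProductSpace ℂ E]
    {K : X → X → ℂ} {v : X → E} (hvK : ∀ s t, inner ℂ (v s) (v t) = K s t) :
    (Matrix.of fun s t ↦ K s t • ContinuousLinearMap.id ℂ ℂ).PosSemidef := by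
  have h := (RKHS.posSemidef_tfae
    (K := Matrix.of fun s t ↦ K s t • ContinuousLinearMap.id ℂ ℂ)).out 0 2
  refine h.2 ⟨?_, fun c ↦ ?_⟩
  · ext s t
    rw [Matrix.conjTranspose_apply]
    have : conj (K t s) = K s t := by rw [← hvK, ← hvK, inner_conj_symm]
    simp [← this, ← ContinuousLinearMap.one_def]
  · have : (c.sum fun x w ↦ c.sum fun x' w' ↦ inner ℂ
        ((Matrix.of fun s t ↦ K s t • ContinuousLinearMap.id ℂ ℂ) x' x w) w') =
        inner ℂ (c.sum fun x w ↦ w • v x) (c.sum fun x w ↦ w • v x) := by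
      simp only [Finsupp.sum, sum_inner, inner_sum, inner_smul_left, inner_smul_right, hvK]
      simp only [Finset.mul_sum]
      rw [Finset.sum_comm]
      refine Finset.sum_congr rfl fun x _ ↦ Finset.sum_congr rfl fun y _ ↦ ?_
      have : conj (K x y) = K y x := by rw [← hvK, ← hvK, inner_conj_symm]
      simp [this]
      left
      ring
    rw [this]
    exact inner_self_nonneg

/-! ### Laguerre series on the half-plane Re z < 1/2 -/

noncomputable section

open Filter Topology

/-- Cauchy–Schwarz against a geometric sequence. -/
theorem summable_and_tsum_norm_mul_pow_le {a : ℕ → ℂ} (ha : Summable fun m ↦ ‖a m‖ ^ 2) {w : ℂ}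
    (hw : ‖w‖ < 1) :
    (Summable fun m ↦ ‖a m‖ * ‖w‖ ^ m) ∧
      ∑' m, ‖a m‖ * ‖w‖ ^ m ≤ √((∑' m, ‖a m‖ ^ 2) / (1 - ‖w‖ ^ 2)) := by
  have hw2 : ‖w‖ ^ 2 < 1 := pow_lt_one₀ (norm_nonneg w) hw two_ne_zero
  have hg : HasSum (fun m ↦ (‖w‖ ^ m) ^ (2 : ℝ)) (1 - ‖w‖ ^ 2)⁻¹ := by
    simpa [← pow_mul, mul_comm] using hasSum_geometric_of_lt_one (sq_nonneg ‖w‖) hw2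
  have ha' : Summable fun m ↦ ‖a m‖ ^ (2 : ℝ) := by simpa using ha
  obtain ⟨h1, h2⟩ := Real.summable_and_inner_le_Lp_mul_Lq_tsum_of_nonneg
    Real.HolderConjugate.two_two (fun m ↦ norm_nonneg (a m)) (fun m ↦ by positivity) ha' hg.summable
  refine ⟨h1, h2.trans_eq ?_⟩
  rw [hg.tsum_eq, ← Real.sqrt_eq_rpow, ← Real.sqrt_eq_rpow,
    ← Real.sqrt_mul (tsum_nonneg fun m ↦ by positivity)]
  simp [div_eq_mul_inv]

theorem hasFPowerSeriesOnBall_tsum {a : ℕ → ℂ} (ha : Summable fun m ↦ ‖a m‖ ^ 2) :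
    HasFPowerSeriesOnBall (fun w ↦ ∑' m, a m * w ^ m) (FormalMultilinearSeries.ofScalars ℂ a)
      0 1 := by
  have hr : 1 ≤ (FormalMultilinearSeries.ofScalars ℂ a).radius := by
    have hb : ∀ m, ‖a m‖ ≤ √(∑' m, ‖a m‖ ^ 2) := fun m ↦
      Real.le_sqrt_of_sq_le (ha.le_tsum m fun _ _ ↦ by positivity)
    refine FormalMultilinearSeries.le_radius_of_bound (r := 1) _ (√(∑' m, ‖a m‖ ^ 2)) fun m ↦ ?_
    simpa [FormalMultilinearSeries.ofScalars_norm] using hb m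
  have := (FormalMultilinearSeries.ofScalars ℂ a).hasFPowerSeriesOnBall (one_pos.trans_le hr)
  refine (this.mono one_pos hr).congr fun w _ ↦ ?_
  refine (FormalMultilinearSeries.ofScalars_sum_eq a w).trans ?_
  simp

/-- The series `∑ aₘ zᵐ / (z - 1)ᵐ⁺¹`. -/
def laguerreSum (a : ℕ → ℂ) (z : ℂ) : ℂ := ∑' m, a m * (z ^ m / (z - 1) ^ (m + 1))

theorem laguerreSum_eq (a : ℕ → ℂ) (z : ℂ) :
    laguerreSum a z = (z - 1)⁻¹ * ∑' m, a m * (z / (z - 1)) ^ m := by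
  rw [laguerreSum, ← tsum_mul_left]
  congr 1 with m
  rw [div_pow, pow_succ]
  simp only [div_eq_mul_inv, mul_inv]
  ring

theorem sub_one_ne_zero_of_re_lt_half {z : ℂ} (hz : z.re < 1 / 2) : z - 1 ≠ 0 := by
  intro h
  rw [sub_eq_zero.1 h, Complex.one_re] at hz
  norm_num at hz

theorem norm_sub_one_sq (z : ℂ) : ‖z - 1‖ ^ 2 = ‖z‖ ^ 2 + (1 - 2 * z.re) := by
  rw [Complex.sq_norm, Complex.sq_norm, Complex.normSq_apply, Complex.normSq_apply]
  simp
  ring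

theorem norm_div_sub_one_lt_one {z : ℂ} (hz : z.re < 1 / 2) : ‖z / (z - 1)‖ < 1 := by
  rw [norm_div, div_lt_one (norm_pos_iff.2 (sub_one_ne_zero_of_re_lt_half hz))]
  refine lt_of_pow_lt_pow_left₀ 2 (norm_nonneg _) ?_
  rw [norm_sub_one_sq]
  linarith

section

variable {a b : ℕ → ℂ}

theorem hasSum_laguerreSum (ha : Summable fun m ↦ ‖a m‖ ^ 2) {z : ℂ} (hz : z.re < 1 / 2) :
    HasSum (fun m ↦ a m * (z ^ m / (z - 1) ^ (m + 1))) (laguerreSum a z) := by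
  refine Summable.hasSum (Summable.of_norm ?_)
  refine ((summable_and_tsum_norm_mul_pow_le ha (norm_div_sub_one_lt_one hz)).1.mul_left
    ‖(z - 1)⁻¹‖).congr fun m ↦ ?_
  rw [← norm_pow, ← norm_mul, ← norm_mul, div_pow, pow_succ]
  simp only [div_eq_mul_inv, mul_inv]
  ring_nf

/-- With w = z/(z-1), 1 - |w|² = (1 - 2 Re z)/|z-1|², so the prefactor 1/(z-1) cancels. The bound is
uniform on Re z ≤ 0 and decays as Re z → -∞. -/
theorem norm_laguerreSum_le (ha : Summable fun m ↦ ‖a m‖ ^ 2) {z : ℂ} (hz : z.re < 1 / 2) :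
    ‖laguerreSum a z‖ ≤ √((∑' m, ‖a m‖ ^ 2) / (1 - 2 * z.re)) := by
  obtain ⟨h1, h2⟩ := summable_and_tsum_norm_mul_pow_le ha (norm_div_sub_one_lt_one hz)
  have h3 : ‖∑' m, a m * (z / (z - 1)) ^ m‖ ≤ ∑' m, ‖a m‖ * ‖z / (z - 1)‖ ^ m := by
    refine (norm_tsum_le_tsum_norm (by simpa using h1)).trans_eq (by simp)
  have hz0 : 0 < ‖z - 1‖ := norm_pos_iff.2 (sub_one_ne_zero_of_re_lt_half hz)
  rw [laguerreSum_eq, norm_mul, norm_inv, inv_mul_le_iff₀ hz0]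
  refine (h3.trans h2).trans_eq ?_
  conv_rhs => rw [← Real.sqrt_sq hz0.le, ← Real.sqrt_mul (sq_nonneg _)]
  congr 1
  have hz1 : 1 - 2 * z.re ≠ 0 := by linarith
  have : 1 - ‖z / (z - 1)‖ ^ 2 = (1 - 2 * z.re) / ‖z - 1‖ ^ 2 := by
    rw [norm_div, div_pow, eq_div_iff (by positivity), sub_mul, div_mul_cancel₀ _ (by positivity),
      norm_sub_one_sq]
    ring
  rw [this]
  field_simp

theorem isOpen_re_lt_half : IsOpen {z : ℂ | z.re < 1 / 2} :=
  isOpen_lt Complex.continuous_re continuous_const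

theorem differentiableOn_laguerreSum (ha : Summable fun m ↦ ‖a m‖ ^ 2) :
    DifferentiableOn ℂ (laguerreSum a) {z | z.re < 1 / 2} := by
  have hf : DifferentiableOn ℂ (fun w : ℂ ↦ ∑' m, a m * w ^ m) (Metric.ball 0 1) := by
    have := (hasFPowerSeriesOnBall_tsum ha).differentiableOn
    rwa [← ENNReal.ofReal_one, Metric.eball_ofReal] at this
  have hs : DifferentiableOn ℂ (fun z : ℂ ↦ z - 1) {z | z.re < 1 / 2} := by fun_prop
  have hne : ∀ z ∈ {z : ℂ | z.re < 1 / 2}, z - 1 ≠ 0 := fun z hz ↦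
    sub_one_ne_zero_of_re_lt_half hz
  refine ((hs.inv hne).mul (hf.comp (differentiableOn_id.div hs hne) fun z hz ↦ ?_)).congr
    fun z _ ↦ laguerreSum_eq a z
  simpa using norm_div_sub_one_lt_one hz

/-- The map w ↦ w/(w-1) is an involution fixing 0, so the power series in w vanishes near 0. -/
theorem eq_zero_of_laguerreSum_eq_zero (ha : Summable fun m ↦ ‖a m‖ ^ 2)
    (h : ∀ z : ℂ, z.re < 1 / 2 → laguerreSum a z = 0) (m : ℕ) : a m = 0 := by
  have hF : ∀ᶠ w in 𝓝 (0 : ℂ), ∑' m, a m * w ^ m = 0 := by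
    have hc : ContinuousAt (fun w : ℂ ↦ (w / (w - 1)).re) 0 :=
      Complex.continuous_re.continuousAt.comp
        (continuousAt_id.div (continuousAt_id.sub continuousAt_const) (by simp))
    have h1 : ∀ᶠ w in 𝓝 (0 : ℂ), (w / (w - 1)).re < 1 / 2 :=
      hc.eventually_lt continuousAt_const (by simp)
    have h2 : ∀ᶠ w in 𝓝 (0 : ℂ), w ≠ 1 := isOpen_ne.eventually_mem zero_ne_one
    filter_upwards [h1, h2] with w hw hw1
    have hw1 : w - 1 ≠ 0 := sub_ne_zero.2 hw1
    have h3 : w / (w - 1) - 1 = (w - 1)⁻¹ := by field_simp; ring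
    have := h _ hw
    rw [laguerreSum_eq, h3, inv_inv] at this
    have h4 : w / (w - 1) / (w - 1)⁻¹ = w := by field_simp
    rw [h4] at this
    exact (mul_eq_zero.1 this).resolve_left hw1
  have := ((hasFPowerSeriesOnBall_tsum ha).hasFPowerSeriesAt.congr hF).eq_zero
  rw [FormalMultilinearSeries.ofScalars_series_eq_zero] at this
  exact congrFun this m

/-- The two series continue each other across the imaginary axis to a bounded entire function. -/
theorem laguerreSum_eq_zero_of_eq_on_imaginary_axis (ha : Summable fun m ↦ ‖a m‖ ^ 2)
    (hb : Summable fun m ↦ ‖b m‖ ^ 2)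
    (h : ∀ t : ℝ, laguerreSum a (Complex.I * t) = laguerreSum b (-(Complex.I * t)))
    {z : ℂ} (hz : z.re < 1 / 2) : laguerreSum a z = 0 := by
  have hda := differentiableOn_laguerreSum ha
  have hopen : IsOpen {z : ℂ | -(1 / 2) < z.re} := isOpen_lt continuous_const Complex.continuous_re
  have hdb : DifferentiableOn ℂ (fun z ↦ laguerreSum b (-z)) {z | -(1 / 2) < z.re} :=
    (differentiableOn_laguerreSum hb).comp (differentiableOn_neg _) fun z hz ↦ by
      simp only [Set.mem_ofPred_eq, Complex.neg_re] at hz ⊢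
      linarith
  -- Identity theorem: the imaginary axis accumulates at 0 inside the overlap strip.
  have hstrip : Set.EqOn (laguerreSum a) (fun z ↦ laguerreSum b (-z))
      ({z | z.re < 1 / 2} ∩ {z | -(1 / 2) < z.re}) := by
    refine AnalyticOnNhd.eqOn_of_preconnected_of_frequently_eq (z₀ := 0)
      ((hda.mono Set.inter_subset_left).analyticOnNhd (isOpen_re_lt_half.inter hopen))
      ((hdb.mono Set.inter_subset_right).analyticOnNhd (isOpen_re_lt_half.inter hopen))
      ((convex_halfSpace_re_lt _).inter (convex_halfSpace_re_gt _)).isPreconnected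
      (by norm_num) ?_
    have ht : Tendsto (fun t : ℝ ↦ Complex.I * t) (𝓝[≠] 0) (𝓝[≠] 0) := by
      refine tendsto_nhdsWithin_iff.2 ⟨?_, ?_⟩
      · have : Continuous fun t : ℝ ↦ Complex.I * t := by fun_prop
        simpa using (this.tendsto 0).mono_left nhdsWithin_le_nhds
      · filter_upwards [self_mem_nhdsWithin] with t ht
        simpa using ht
    exact ht.frequently (Eventually.of_forall h).frequently
  let E : ℂ → ℂ := fun z ↦ if z.re < 1 / 2 then laguerreSum a z else laguerreSum b (-z)
  have hEa : ∀ z : ℂ, z.re < 1 / 2 → E z = laguerreSum a z := fun z hz ↦ if_pos hz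
  have hEb : ∀ z : ℂ, -(1 / 2) < z.re → E z = laguerreSum b (-z) := fun z hz ↦ by
    by_cases h1 : z.re < 1 / 2
    · rw [hEa z h1, hstrip ⟨h1, hz⟩]
    · exact if_neg h1
  have hE : Differentiable ℂ E := fun z ↦ by
    rcases lt_or_ge z.re (1 / 2) with h1 | h1
    · exact ((hda.congr hEa).differentiableAt (isOpen_re_lt_half.mem_nhds h1))
    · exact ((hdb.congr hEb).differentiableAt
        (hopen.mem_nhds (show -(1 / 2) < z.re by linarith)))
  have hA : 0 ≤ ∑' m, ‖a m‖ ^ 2 := tsum_nonneg fun m ↦ by positivity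
  have hB : 0 ≤ ∑' m, ‖b m‖ ^ 2 := tsum_nonneg fun m ↦ by positivity
  have hbdd : Bornology.IsBounded (Set.range E) := by
    refine isBounded_iff_forall_norm_le.2
      ⟨√(∑' m, ‖a m‖ ^ 2) + √(∑' m, ‖b m‖ ^ 2), ?_⟩
    rintro _ ⟨z, rfl⟩
    -- Splitting at Re z = 0 keeps the denominator of each norm bound at least 1.
    rcases le_total z.re 0 with h1 | h1
    · rw [hEa z (by linarith)]
      refine (norm_laguerreSum_le ha (by linarith)).trans ?_
      refine le_add_of_le_of_nonneg (Real.sqrt_le_sqrt (div_le_self hA ?_)) (Real.sqrt_nonneg _)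
      linarith
    · have h2 : (-z).re ≤ 0 := by simpa using h1
      rw [hEb z (by linarith)]
      refine (norm_laguerreSum_le hb (by linarith)).trans ?_
      refine le_add_of_nonneg_of_le (Real.sqrt_nonneg _) (Real.sqrt_le_sqrt (div_le_self hB ?_))
      linarith
  have hlim : Tendsto (fun x : ℝ ↦ √((∑' m, ‖a m‖ ^ 2) / (1 + 2 * x))) atTop (𝓝 0) := by
    rw [← Real.sqrt_zero]
    refine (Real.continuous_sqrt.tendsto 0).comp (Tendsto.div_atTop tendsto_const_nhds ?_)
    exact tendsto_atTop_add_const_left _ _ (tendsto_id.const_mul_atTop two_pos)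
  rw [← hEa z hz]
  refine norm_le_zero_iff.1 (ge_of_tendsto hlim ?_)
  filter_upwards [eventually_ge_atTop 0] with x hx
  have hre : ((-x : ℝ) : ℂ).re < 1 / 2 := by
    rw [Complex.ofReal_re]
    linarith
  rw [hE.apply_eq_apply_of_bounded hbdd z (-x : ℝ), hEa _ hre]
  refine (norm_laguerreSum_le ha hre).trans_eq ?_
  rw [Complex.ofReal_re]
  ring_nf

/-- Square-summable coefficient sequences are determined by the boundary values on the imaginary
axis. -/
theorem eq_zero_of_laguerreSum_eq_on_imaginary_axis (ha : Summable fun m ↦ ‖a m‖ ^ 2)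
    (hb : Summable fun m ↦ ‖b m‖ ^ 2)
    (h : ∀ t : ℝ, laguerreSum a (Complex.I * t) = laguerreSum b (-(Complex.I * t))) :
    (∀ m, a m = 0) ∧ ∀ m, b m = 0 := by
  refine ⟨eq_zero_of_laguerreSum_eq_zero ha fun z hz ↦
      laguerreSum_eq_zero_of_eq_on_imaginary_axis ha hb h hz,
    eq_zero_of_laguerreSum_eq_zero hb fun z hz ↦
      laguerreSum_eq_zero_of_eq_on_imaginary_axis hb ha (fun t ↦ ?_) hz⟩
  simpa using (h (-t)).symm

end

end

/-! ### Expansions of the Cauchy kernel -/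

theorem cauchyPsi_ofNat (m : ℕ) (t : ℝ) : cauchyPsi m t =
    -(1 / (√2 : ℂ)) * ((Complex.I * t) ^ m / (Complex.I * t - 1) ^ (m + 1)) := rfl

/-- Puts the negative indices in the form of the nonnegative ones, with -it for it and the opposite
sign. -/
theorem cauchyPsi_negSucc (m : ℕ) (t : ℝ) : cauchyPsi (Int.negSucc m) t =
    1 / (√2 : ℂ) * ((-(Complex.I * t)) ^ m / (-(Complex.I * t) - 1) ^ (m + 1)) := by
  have h1 : -(Complex.I * t) - 1 = -(Complex.I * t + 1) := by ring
  rw [cauchyPsi, h1, neg_pow (Complex.I * t), neg_pow (Complex.I * t + 1), pow_succ (-1 : ℂ) m,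
    mul_assoc, mul_div_mul_left _ _ (pow_ne_zero m (by norm_num))]
  rw [neg_one_mul, div_neg]
  ring

theorem conj_cauchyPsi (m : ℕ) (t : ℝ) :
    conj (cauchyPsi m t) = -cauchyPsi (Int.negSucc m) t := by
  rw [cauchyPsi_ofNat, cauchyPsi_negSucc]
  simp

theorem conj_cauchyPsi_negSucc (m : ℕ) (t : ℝ) :
    conj (cauchyPsi (Int.negSucc m) t) = -cauchyPsi m t := by
  rw [← neg_eq_iff_eq_neg.2 (conj_cauchyPsi m t)]
  simp

theorem cauchyKernel_comm (t u : ℝ) : cauchyKernel t u = cauchyKernel u t := by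
  rw [cauchyKernel, cauchyKernel, ← neg_sub, neg_sq]

theorem one_div_sqrt_two_mul_self : (1 / (√2 : ℂ)) * (1 / (√2 : ℂ)) = 1 / 2 := by
  rw [div_mul_div_comm, ← Complex.ofReal_mul, Real.mul_self_sqrt (by norm_num)]
  simp

/-- Geometric series whose ratio is a product of two points of the unit disc. Its sum is one partial
fraction of 1/(1+x²), x = t - u. -/
theorem hasSum_conj_cauchyPsi_mul (t u : ℝ) :
    HasSum (fun m : ℕ ↦ conj (cauchyPsi m t) * cauchyPsi m u)
      (1 / 2 * (1 + Complex.I * (t - u))⁻¹) := by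
  have hlt (x : ℂ) (hx : x.re = 0) : ‖x / (x - 1)‖ < 1 :=
    norm_div_sub_one_lt_one (by rw [hx]; norm_num)
  have hne (x : ℂ) (hx : x.re = 0) : x - 1 ≠ 0 :=
    sub_one_ne_zero_of_re_lt_half (by rw [hx]; norm_num)
  have ht : (-(Complex.I * t)).re = 0 := by simp
  have hu : (Complex.I * u).re = 0 := by simp
  have hq : ‖-(Complex.I * t) / (-(Complex.I * t) - 1) *
      (Complex.I * u / (Complex.I * u - 1))‖ < 1 := by
    rw [norm_mul]
    exact mul_lt_one_of_nonneg_of_lt_one_left (norm_nonneg _) (hlt _ ht) (hlt _ hu).le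
  have h3 : 1 + Complex.I * (t - u) ≠ 0 := fun h ↦ by simpa using congrArg Complex.re h
  have ht := hne _ ht
  have hu := hne _ hu
  have h := (hasSum_geometric_of_norm_lt_one hq).mul_left
    (1 / 2 * ((-(Complex.I * t) - 1)⁻¹ * (Complex.I * u - 1)⁻¹))
  have hsum : 1 / 2 * ((-(Complex.I * t) - 1)⁻¹ * (Complex.I * u - 1)⁻¹) *
      (1 - -(Complex.I * t) / (-(Complex.I * t) - 1) * (Complex.I * u / (Complex.I * u - 1)))⁻¹ =
      1 / 2 * (1 + Complex.I * (t - u))⁻¹ := by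
    rw [mul_assoc, ← mul_inv, ← mul_inv]
    congr 2
    field_simp
    ring
  rw [hsum] at h
  refine h.congr_fun fun m ↦ ?_
  rw [conj_cauchyPsi, cauchyPsi_ofNat, cauchyPsi_negSucc, ← one_div_sqrt_two_mul_self,
    mul_pow (_ / _) (_ / _), div_pow, div_pow, pow_succ, pow_succ]
  simp only [div_eq_mul_inv, mul_inv]
  ring

theorem hasSum_conj_cauchyPsi_negSucc_mul (t u : ℝ) :
    HasSum (fun m : ℕ ↦ conj (cauchyPsi (Int.negSucc m) t) * cauchyPsi (Int.negSucc m) u)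
      (1 / 2 * (1 + Complex.I * (u - t))⁻¹) := by
  convert hasSum_conj_cauchyPsi_mul u t using 2 with m
  rw [conj_cauchyPsi_negSucc, conj_cauchyPsi]
  ring

theorem half_inv_add_half_inv (t u : ℝ) :
    1 / 2 * (1 + Complex.I * (t - u))⁻¹ + 1 / 2 * (1 + Complex.I * (u - t))⁻¹ =
      (cauchyKernel t u : ℂ) := by
  have h1 : 1 + Complex.I * (t - u) ≠ 0 := fun h ↦ by simpa using congrArg Complex.re h
  have h2 : 1 + Complex.I * (u - t) ≠ 0 := fun h ↦ by simpa using congrArg Complex.re h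
  have h3 : (1 + Complex.I * (t - u)) * (1 + Complex.I * (u - t)) = (1 + (t - u) ^ 2 : ℂ) := by
    linear_combination (-(t - u) ^ 2 : ℂ) * Complex.I_sq
  rw [cauchyKernel]
  push_cast
  rw [← h3]
  field_simp
  ring

theorem hasSum_cauchyKernel (t u : ℝ) :
    HasSum (fun m : ℤ ↦ conj (cauchyPsi m t) * cauchyPsi m u) (cauchyKernel t u : ℂ) := by
  have h1 := hasSum_conj_cauchyPsi_mul t u
  have h2 := hasSum_conj_cauchyPsi_negSucc_mul t u
  rw [← half_inv_add_half_inv]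
  exact HasSum.of_nat_of_neg_add_one h1 (by simpa only [Int.negSucc_eq] using h2)

theorem conj_cauchyAlpha (m : ℕ) (t : ℝ) : conj (cauchyAlpha m t) = cauchyAlpha m t := by
  simp [cauchyAlpha, add_comm]

theorem conj_cauchyBeta (m : ℕ) (t : ℝ) : conj (cauchyBeta m t) = cauchyBeta m t := by
  simp [cauchyBeta]
  ring

theorem cauchyAlpha_mul_add_cauchyBeta_mul (m : ℕ) (t u : ℝ) :
    cauchyAlpha m t * cauchyAlpha m u + cauchyBeta m t * cauchyBeta m u =
      conj (cauchyPsi m t) * cauchyPsi m u +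
        conj (cauchyPsi (Int.negSucc m) t) * cauchyPsi (Int.negSucc m) u := by
  rw [conj_cauchyPsi_negSucc, ← neg_eq_iff_eq_neg.2 (conj_cauchyPsi m u), cauchyAlpha, cauchyAlpha,
    cauchyBeta, cauchyBeta]
  have h : 1 / (Complex.I * (√2 : ℂ)) = -Complex.I * (1 / (√2 : ℂ)) := by
    simp [mul_comm]
  rw [h]
  linear_combination
    ((cauchyPsi m t + conj (cauchyPsi m t)) * (cauchyPsi m u + conj (cauchyPsi m u)) +
      Complex.I ^ 2 * (cauchyPsi m t - conj (cauchyPsi m t)) *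
        (cauchyPsi m u - conj (cauchyPsi m u))) * one_div_sqrt_two_mul_self +
    1 / 2 * (cauchyPsi m t - conj (cauchyPsi m t)) *
        (cauchyPsi m u - conj (cauchyPsi m u)) * Complex.I_sq

theorem summable_norm_mul_norm_cauchyPsi (t u : ℝ) :
    Summable fun m : ℕ ↦ ‖cauchyPsi m t‖ * ‖cauchyPsi m u‖ := by
  simpa using (hasSum_conj_cauchyPsi_mul t u).summable.norm

/-- The termwise identity controls only the α and β products together; domination by ψ makes each
series converge by itself. -/
theorem summable_mul_of_norm_le_cauchyPsi {f : ℕ → ℝ → ℂ} {C : ℝ}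
    (hf : ∀ m t, ‖f m t‖ ≤ C * ‖cauchyPsi m t‖) (t u : ℝ) :
    Summable fun m ↦ f m t * f m u := by
  refine Summable.of_norm_bounded ((summable_norm_mul_norm_cauchyPsi t u).mul_left (C * C))
    fun m ↦ ?_
  rw [norm_mul, mul_mul_mul_comm]
  exact mul_le_mul (hf m t) (hf m u) (norm_nonneg _) ((norm_nonneg _).trans (hf m t))

theorem norm_cauchyAlpha_le (m : ℕ) (t : ℝ) : ‖cauchyAlpha m t‖ ≤ 1 / √2 * 2 * ‖cauchyPsi m t‖ := by
  rw [cauchyAlpha, norm_mul, mul_assoc]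
  refine mul_le_mul (by simp [abs_of_nonneg]) ((norm_add_le _ _).trans_eq ?_) (norm_nonneg _) (by positivity)
  rw [RCLike.norm_conj]
  ring

theorem norm_cauchyBeta_le (m : ℕ) (t : ℝ) : ‖cauchyBeta m t‖ ≤ 1 / √2 * 2 * ‖cauchyPsi m t‖ := by
  rw [cauchyBeta, norm_mul, mul_assoc]
  refine mul_le_mul (by simp [abs_of_nonneg]) ((norm_sub_le _ _).trans_eq ?_) (norm_nonneg _) (by positivity)
  rw [RCLike.norm_conj]
  ring

theorem summable_cauchyAlpha_mul (t u : ℝ) :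
    Summable fun m ↦ cauchyAlpha m t * cauchyAlpha m u :=
  summable_mul_of_norm_le_cauchyPsi norm_cauchyAlpha_le t u

theorem summable_cauchyBeta_mul (t u : ℝ) :
    Summable fun m ↦ cauchyBeta m t * cauchyBeta m u :=
  summable_mul_of_norm_le_cauchyPsi norm_cauchyBeta_le t u

theorem tsum_cauchyAlpha_mul_add_tsum_cauchyBeta_mul (t u : ℝ) :
    (∑' m, cauchyAlpha m t * cauchyAlpha m u) + ∑' m, cauchyBeta m t * cauchyBeta m u =
      (cauchyKernel t u : ℂ) := by
  rw [← (summable_cauchyAlpha_mul t u).tsum_add (summable_cauchyBeta_mul t u),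
    ← half_inv_add_half_inv]
  simp only [cauchyAlpha_mul_add_cauchyBeta_mul]
  exact ((hasSum_conj_cauchyPsi_mul t u).add (hasSum_conj_cauchyPsi_negSucc_mul t u)).tsum_eq

/-- The functions `α_m` and `β_m` as one family indexed by `ℕ ⊕ ℕ`. -/
noncomputable def cauchyAlphaBeta : ℕ ⊕ ℕ → ℝ → ℂ := Sum.elim cauchyAlpha cauchyBeta

theorem hasSum_cauchyAlphaBeta (s t : ℝ) :
    HasSum (fun i ↦ cauchyAlphaBeta i s * conj (cauchyAlphaBeta i t)) (cauchyKernel s t : ℂ) := by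
  rw [← tsum_cauchyAlpha_mul_add_tsum_cauchyBeta_mul]
  refine HasSum.sum ?_ ?_
  · simpa [Function.comp_def, cauchyAlphaBeta, conj_cauchyAlpha] using
      (summable_cauchyAlpha_mul s t).hasSum
  · simpa [Function.comp_def, cauchyAlphaBeta, conj_cauchyBeta] using
      (summable_cauchyBeta_mul s t).hasSum

/-! ### Independence over ℓ² coefficients -/

section Independence

variable {a b : ℕ → ℂ}

theorem hasSum_mul_cauchyPsi (ha : Summable fun m ↦ ‖a m‖ ^ 2) (t : ℝ) :
    HasSum (fun m : ℕ ↦ a m * cauchyPsi m t)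
      (-(1 / (√2 : ℂ)) * laguerreSum a (Complex.I * t)) := by
  refine ((hasSum_laguerreSum ha (z := Complex.I * t) (by simp)).mul_left
    (-(1 / (√2 : ℂ)))).congr_fun fun m ↦ ?_
  rw [cauchyPsi_ofNat]
  ring

theorem hasSum_mul_cauchyPsi_negSucc (hb : Summable fun m ↦ ‖b m‖ ^ 2) (t : ℝ) :
    HasSum (fun m : ℕ ↦ b m * cauchyPsi (Int.negSucc m) t)
      (1 / (√2 : ℂ) * laguerreSum b (-(Complex.I * t))) := by
  refine ((hasSum_laguerreSum hb (z := -(Complex.I * t)) (by simp)).mul_left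
    (1 / (√2 : ℂ))).congr_fun fun m ↦ ?_
  rw [cauchyPsi_negSucc]
  ring

theorem eq_zero_of_tsum_cauchyPsi_eq_zero (ha : Summable fun m ↦ ‖a m‖ ^ 2)
    (hb : Summable fun m ↦ ‖b m‖ ^ 2)
    (h : ∀ t, (∑' m : ℕ, a m * cauchyPsi m t) + ∑' m : ℕ, b m * cauchyPsi (Int.negSucc m) t = 0) :
    (∀ m, a m = 0) ∧ ∀ m, b m = 0 := by
  refine eq_zero_of_laguerreSum_eq_on_imaginary_axis ha hb fun t ↦ ?_
  have := h t
  rw [(hasSum_mul_cauchyPsi ha t).tsum_eq, (hasSum_mul_cauchyPsi_negSucc hb t).tsum_eq,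
    neg_mul, neg_add_eq_zero] at this
  exact mul_left_cancel₀ (by simp) this

end Independence

theorem eq_zero_of_hasSum_cauchyPsi (c : ℤ → ℂ) (hc : Summable fun i ↦ ‖c i‖ ^ 2)
    (h : ∀ t, HasSum (fun i ↦ c i * cauchyPsi i t) 0) (i : ℤ) : c i = 0 := by
  have hinj : Function.Injective Int.negSucc := fun _ _ ↦ Int.negSucc.inj
  have ha : Summable fun m : ℕ ↦ ‖c m‖ ^ 2 := hc.comp_injective Nat.cast_injective
  have hb : Summable fun m : ℕ ↦ ‖c (Int.negSucc m)‖ ^ 2 := hc.comp_injective hinj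
  obtain ⟨h1, h2⟩ := eq_zero_of_tsum_cauchyPsi_eq_zero ha hb fun t ↦ by
    refine HasSum.unique (HasSum.of_nat_of_neg_add_one (f := fun i ↦ c i * cauchyPsi i t)
      (hasSum_mul_cauchyPsi ha t).summable.hasSum ?_) (h t)
    simpa only [Int.negSucc_eq] using (hasSum_mul_cauchyPsi_negSucc hb t).summable.hasSum
  cases i with
  | ofNat m => exact h1 m
  | negSucc m => exact h2 m

theorem summable_norm_sq_add {a b : ℕ → ℂ} (ha : Summable fun m ↦ ‖a m‖ ^ 2)
    (hb : Summable fun m ↦ ‖b m‖ ^ 2) (x y : ℂ) : Summable fun m ↦ ‖x * a m + y * b m‖ ^ 2 := by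
  refine Summable.of_nonneg_of_le (fun m ↦ by positivity) (fun m ↦ ?_)
    ((ha.mul_left (2 * ‖x‖ ^ 2)).add (hb.mul_left (2 * ‖y‖ ^ 2)))
  have h1 : ‖x * a m + y * b m‖ ≤ ‖x‖ * ‖a m‖ + ‖y‖ * ‖b m‖ := by
    simpa using norm_add_le (x * a m) (y * b m)
  have h2 := pow_le_pow_left₀ (norm_nonneg _) h1 2
  linarith [sq_nonneg (‖x‖ * ‖a m‖ - ‖y‖ * ‖b m‖)]

theorem eq_zero_of_hasSum_cauchyAlphaBeta (c : ℕ ⊕ ℕ → ℂ) (hc : Summable fun i ↦ ‖c i‖ ^ 2)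
    (h : ∀ t, HasSum (fun i ↦ c i * cauchyAlphaBeta i t) 0) (i : ℕ ⊕ ℕ) : c i = 0 := by
  have hl : Summable fun m : ℕ ↦ ‖c (.inl m)‖ ^ 2 := hc.comp_injective Sum.inl_injective
  have hr : Summable fun m : ℕ ↦ ‖c (.inr m)‖ ^ 2 := hc.comp_injective Sum.inr_injective
  set p : ℂ := 1 / (√2 : ℂ) with hp
  set q : ℂ := 1 / (Complex.I * (√2 : ℂ)) with hq
  have hp0 : p ≠ 0 := by simp [hp]
  have hq0 : q ≠ 0 := by simp [hq]
  -- Since conj ψ_m = -ψ_{-m-1}, these are the coefficients of ψ_m and, with -p, of ψ_{-m-1}.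
  have ha := summable_norm_sq_add hl hr p q
  have hb := summable_norm_sq_add hl hr (-p) q
  obtain ⟨h1, h2⟩ := eq_zero_of_tsum_cauchyPsi_eq_zero ha hb fun t ↦ by
    have hαs := (h t).summable.comp_injective Sum.inl_injective
    have hβs := (h t).summable.comp_injective Sum.inr_injective
    have h0 := (hαs.hasSum.sum hβs.hasSum).unique (h t)
    rw [← hαs.tsum_add hβs] at h0
    rw [← (hasSum_mul_cauchyPsi ha t).summable.tsum_add
      (hasSum_mul_cauchyPsi_negSucc hb t).summable, ← h0]
    refine tsum_congr fun m ↦ ?_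
    simp only [Function.comp_apply, cauchyAlphaBeta, Sum.elim_inl, Sum.elim_inr, cauchyAlpha,
      cauchyBeta, conj_cauchyPsi, ← hp, ← hq]
    ring
  have h3 (m : ℕ) : c (.inl m) = 0 := by
    refine (mul_eq_zero.1 ?_).resolve_left hp0
    linear_combination 1 / 2 * h1 m - 1 / 2 * h2 m
  have h4 (m : ℕ) : c (.inr m) = 0 := by
    refine (mul_eq_zero.1 ?_).resolve_left hq0
    linear_combination 1 / 2 * h1 m + 1 / 2 * h2 m
  cases i with
  | inl m => exact h3 m
  | inr m => exact h4 m

/-! ### Application to the Cauchy RKHS -/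

theorem kernel_apply_one {H : Type*} [NormedAddCommGroup H] [InnerProductSpace ℂ H]
    [CompleteSpace H] [RKHS ℂ H ℝ ℂ] (hH : RKHS.kernel H = cauchyKernelMatrix) (s t : ℝ) :
    RKHS.kernel H s t 1 = (cauchyKernel s t : ℂ) := by
  rw [hH, cauchyKernelMatrix]
  simp

theorem posSemidef_cauchyKernelMatrix : cauchyKernelMatrix.PosSemidef := by
  obtain ⟨v, -, hv⟩ := exists_lp_featureMap hasSum_cauchyAlphaBeta
  exact posSemidef_of_inner_eq hv

theorem mainTheorem3 :
    -- the Cauchy kernel is a positive semidefinite kernel, so it has an RKHS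
    cauchyKernelMatrix.PosSemidef ∧
    -- `α_m` and `β_m` are real-valued
    (∀ (m : ℕ) (t : ℝ), (cauchyAlpha m t).im = 0 ∧ (cauchyBeta m t).im = 0) ∧
    -- orthonormal bases of the RKHS `H` of complex functions on `ℝ` with kernel `r`
    (∀ (H : Type*) [NormedAddCommGroup H] [InnerProductSpace ℂ H] [CompleteSpace H]
        [RKHS ℂ H ℝ ℂ], RKHS.kernel H = cauchyKernelMatrix →
      (∃ b : HilbertBasis ℤ ℂ H, ∀ (m : ℤ) (t : ℝ), (b m) t = cauchyPsi m t) ∧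
      (∃ b : HilbertBasis (ℕ ⊕ ℕ) ℂ H,
        (∀ (m : ℕ) (t : ℝ), (b (Sum.inl m)) t = cauchyAlpha m t) ∧
        (∀ (m : ℕ) (t : ℝ), (b (Sum.inr m)) t = cauchyBeta m t))) ∧
    -- pointwise convergent expansions of the kernel
    (∀ t u : ℝ,
      HasSum (fun m : ℤ ↦ conj (cauchyPsi m t) * cauchyPsi m u) (cauchyKernel t u : ℂ) ∧
      Summable (fun m : ℕ ↦ cauchyAlpha m t * cauchyAlpha m u) ∧
      Summable (fun m : ℕ ↦ cauchyBeta m t * cauchyBeta m u) ∧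
      (∑' m : ℕ, cauchyAlpha m t * cauchyAlpha m u) +
        (∑' m : ℕ, cauchyBeta m t * cauchyBeta m u) = (cauchyKernel t u : ℂ)) := by
  refine ⟨posSemidef_cauchyKernelMatrix, fun m t ↦ ⟨?_, ?_⟩, fun H _ _ _ _ hH ↦ ⟨?_, ?_⟩,
    fun t u ↦ ⟨hasSum_cauchyKernel t u, summable_cauchyAlpha_mul t u, summable_cauchyBeta_mul t u,
      tsum_cauchyAlpha_mul_add_tsum_cauchyBeta_mul t u⟩⟩
  · exact Complex.conj_eq_iff_im.1 (conj_cauchyAlpha m t)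
  · exact Complex.conj_eq_iff_im.1 (conj_cauchyBeta m t)
  · refine RKHS.exists_hilbertBasis_of_hasSum (fun s t ↦ ?_) eq_zero_of_hasSum_cauchyPsi
    -- The basis criterion conjugates the second factor, the ψ expansion the first; symmetry of r
    -- reconciles them.
    rw [kernel_apply_one hH, cauchyKernel_comm]
    simpa only [mul_comm] using hasSum_cauchyKernel t s
  · obtain ⟨b, hb⟩ := RKHS.exists_hilbertBasis_of_hasSum (H := H) (e := cauchyAlphaBeta)
      (fun s t ↦ kernel_apply_one hH s t ▸ hasSum_cauchyAlphaBeta s t)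
      eq_zero_of_hasSum_cauchyAlphaBeta
    exact ⟨b, fun m t ↦ hb _ t, fun m t ↦ hb _ t⟩
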